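/- For points $p=(p_1,p_2)$, $q=(q_1,q_2)$ of the plane let $d_M(p,q)=|p_1-q_1|+|p_2-q_2|$ be the Manhattan distance. For a rectangle $R=[a_1,b_1]\times[a_2,b_2]$ with $a_1<b_1$, $a_2<b_2$, a finite set $P\subset R$ and $p\in P$, the Voronoi cell of $p$ is $$V^P(p)=\{x\in R : d_M(x,p)<d_M(x,q)\text{ for all } q\in P\setminus\{p\}\}.$$ The set $P$ is called balanced in $R$ if all its Voronoi cells have the same area and every $p\in P$ minimizes, among all points of the plane, the average Manhattan distance to the points of its own cell $V^P(p)$. A region is called a rectangle if its closure is a non-degenerate closed rectangle (with sides in any direction). Theorem. For every natural number $n\notin\{1,7\}$ there are a rectangle $R=[a_1,b_1]\times[a_2,b_2]$ with $a_1<b_1$, $a_2<b_2$ and a set $P\subset R$ of exactly $n$ points such that $P$ is balanced in $R$ and no Voronoi cell $V^P(p)$, $p\in P$, is a rectangle. (For $n=0$ this is trivial.) -/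

import Mathlib

open MeasureTheory

namespace ManhattanVoronoi

/-- The Manhattan distance in the plane. -/
noncomputable def manhattanDist (p q : ℝ × ℝ) : ℝ :=
  |p.1 - q.1| + |p.2 - q.2|

/-- The dominance region `D(p₁, p₂)` in `R`: points of `R` strictly closer to `p₁` than to `p₂`. -/
def dominance (R : Set (ℝ × ℝ)) (p₁ p₂ : ℝ × ℝ) : Set (ℝ × ℝ) :=
  {x | x ∈ R ∧ manhattanDist x p₁ < manhattanDist x p₂}

/-- The Manhattan Voronoi cell of `p` with respect to `P`, inside `R`. Intersecting with `R`
only matters when `P \ {p}` is empty, in which case the cell is all of `R`. -/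
def voronoiCell (R : Set (ℝ × ℝ)) (P : Finset (ℝ × ℝ)) (p : ℝ × ℝ) : Set (ℝ × ℝ) :=
  R ∩ ⋂ q ∈ (P : Set (ℝ × ℝ)) \ {p}, dominance R p q

/-- A point set `P` is balanced in `R`:
*fairness*, all Voronoi cells have the same area, and
*local optimality*, each `p ∈ P` minimizes, among all points of the plane, the average Manhattan
distance to the points of its Voronoi cell. -/
structure Balanced (R : Set (ℝ × ℝ)) (P : Finset (ℝ × ℝ)) : Prop where
  fairness : ∀ p₁ ∈ P, ∀ p₂ ∈ P, volume (voronoiCell R P p₁) = volume (voronoiCell R P p₂)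
  local_optimality : ∀ p ∈ P, ∀ q : ℝ × ℝ,
    (⨍ x in voronoiCell R P p, manhattanDist x p) ≤ ⨍ x in voronoiCell R P p, manhattanDist x q

/-- A region of the plane is a rectangle, in any orientation and regardless of which boundary
points belong to it: its closure is spanned from a corner `o` by two nonzero orthogonal edge
vectors `u` and `v`. -/
def IsRectangle (S : Set (ℝ × ℝ)) : Prop :=
  ∃ o u v : ℝ × ℝ, u ≠ 0 ∧ v ≠ 0 ∧ u.1 * v.1 + u.2 * v.2 = 0 ∧
    closure S = {x | ∃ s ∈ Set.Icc (0 : ℝ) 1, ∃ t ∈ Set.Icc (0 : ℝ) 1, x = o + s • u + t • v}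

end ManhattanVoronoi

/-! Manhattan distance is a sum over the two coordinates, so a point is an optimal location as soon
as the horizontal and the vertical line through it each halve the area of its cell
(`setIntegral_abs_sub_le`). For cells that are fans over an interval of first coordinates, this and
fairness become linear equations between the areas of the four quadrants at the point
(`hasCore_of_fan`).

Rectangles of equal width are stacked. If the point sets on the two sides of a common edge have the
same distance to each point of that edge, no cell crosses it, and the cells survive up to boundary
points (`StripConfig.glue`). It remains to find bricks whose cells satisfy the quadrant equations.

Over width 49 with cells of area 588, there are two kinds of row: a single in the middle, or a pair
at `±14`. A single row facing a pair row at vertical distance 18 has a bent bisector; mirror edges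
lie at distance 6 from singles and 12 from pairs. The bricks single-pair, pair-single and
pair-single-pair have 3, 3 and 5 points. Stacks ending in a pair thus have `5i + 6j` or `3 + 5i +
6j` points, which covers 3, 5, 6 and everything from 8 on, but not 7. The cases 2 and 4 come from a
skew two-point brick and from that brick glued to its mirror image.

Cells fail to be rectangles because their width is not concave, or because they are not centrally
symmetric. -/

namespace ManhattanVoronoi

open Set

/-! ### Two obstructions to being a rectangle -/

/-- A rectangle in the plane has a convex closure. -/
lemma IsRectangle.convex_closure {S : Set (ℝ × ℝ)} (h : IsRectangle S) : Convex ℝ (closure S) := by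
  obtain ⟨o, u, v, -, -, -, h⟩ := h
  rw [h]
  rintro _ ⟨s, hs, t, ht, rfl⟩ _ ⟨s', hs', t', ht', rfl⟩ a b ha hb hab
  refine ⟨a * s + b * s', convex_Icc 0 1 hs hs' ha hb hab,
    a * t + b * t', convex_Icc 0 1 ht ht' ha hb hab, ?_⟩
  obtain rfl : b = 1 - a := by linarith
  ext <;> simp <;> ring

/-- A rectangle in the plane has a centrally symmetric closure. -/
lemma IsRectangle.symmetric_closure {S : Set (ℝ × ℝ)} (h : IsRectangle S) :
    ∃ c : ℝ × ℝ, ∀ x ∈ closure S, c - x ∈ closure S := by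
  obtain ⟨o, u, v, -, -, -, h⟩ := h
  rw [h]
  refine ⟨o + o + u + v, ?_⟩
  rintro _ ⟨s, hs, t, ht, rfl⟩
  refine ⟨1 - s, ⟨by linarith [hs.2], by linarith [hs.1]⟩, 1 - t,
    ⟨by linarith [ht.2], by linarith [ht.1]⟩, ?_⟩
  ext <;> simp <;> ring

/-! ### Medians -/

/-- A median of `X` minimizes the mean absolute deviation. -/
lemma setIntegral_abs_sub_le {U : Set (ℝ × ℝ)} (hfin : volume U ≠ ⊤)
    {X : ℝ × ℝ → ℝ} (hX : Continuous X) {p : ℝ}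
    (hint : ∀ q, IntegrableOn (fun x => |X x - q|) U)
    (hmed : volume (U ∩ {x | X x < p}) = volume (U ∩ {x | p < X x})) (q : ℝ) :
    ∫ x in U, |X x - p| ≤ ∫ x in U, |X x - q| := by
  have hlt : MeasurableSet {x | X x < p} := measurableSet_lt hX.measurable measurable_const
  have hgt : MeasurableSet {x | p < X x} := measurableSet_lt measurable_const hX.measurable
  have i1 : IntegrableOn ({x | X x < p}.indicator fun _ => q - p) U :=
    (integrableOn_const hfin).indicator hlt
  have i2 : IntegrableOn ({x | p < X x}.indicator fun _ => q - p) U :=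
    (integrableOn_const hfin).indicator hgt
  have e1 : ∫ x in U, {x | X x < p}.indicator (fun _ => q - p) x =
      ∫ x in U, {x | p < X x}.indicator (fun _ => q - p) x := by
    rw [setIntegral_indicator hlt, setIntegral_indicator hgt, setIntegral_const, setIntegral_const,
      measureReal_def, measureReal_def, hmed]
  -- The correction by `±(q - p)` makes the inequality hold pointwise, and its integral vanishes
  -- because `p` is a median.
  have key : ∫ x in U, (|X x - p| + ({x | X x < p}.indicator (fun _ => q - p) x -
      {x | p < X x}.indicator (fun _ => q - p) x)) ≤ ∫ x in U, |X x - q| := by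
    refine integral_mono ((hint p).add (i1.sub i2)) (hint q) fun x => ?_
    rcases lt_trichotomy (X x) p with h | h | h
    · have h' : ¬ p < X x := by linarith
      simp only [indicator, mem_ofPred_eq, h, h', if_true, if_false]
      rw [abs_of_neg (by linarith : X x - p < 0)]
      linarith [neg_abs_le (X x - q)]
    · simp [indicator, h]
    · have h' : ¬ X x < p := by linarith
      simp only [indicator, mem_ofPred_eq, h, h', if_true, if_false]
      rw [abs_of_pos (by linarith : 0 < X x - p)]
      linarith [le_abs_self (X x - q)]
  have e2 := integral_add (hint p) (i1.sub i2)
  have e3 := integral_sub i1 i2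
  simp only [Pi.sub_apply] at e2
  linarith

/-! ### Fans: closure, area and optimal location -/

/-- An open fan around `p`: over `t ∈ (t₀, t₁)` it reaches `l t` below and `r t` above `p.2`. -/
def fan (l r : ℝ → ℝ) (p : ℝ × ℝ) (t₀ t₁ : ℝ) : Set (ℝ × ℝ) :=
  regionBetween (fun t => p.2 - l t) (fun t => p.2 + r t) (Ioo t₀ t₁)

/-- The closed counterpart of `fan`. -/
def closedFan (l r : ℝ → ℝ) (p : ℝ × ℝ) (t₀ t₁ : ℝ) : Set (ℝ × ℝ) :=
  {x | x.1 ∈ Icc t₀ t₁ ∧ x.2 ∈ Icc (p.2 - l x.1) (p.2 + r x.1)}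

variable {l r : ℝ → ℝ} {p : ℝ × ℝ} {t₀ t₁ : ℝ}

lemma isOpen_fan (hl : Continuous l) (hr : Continuous r) : IsOpen (fan l r p t₀ t₁) := by
  have h1 : IsOpen {x : ℝ × ℝ | x.1 ∈ Ioo t₀ t₁} := isOpen_Ioo.preimage continuous_fst
  have h2 : IsOpen {x : ℝ × ℝ | p.2 - l x.1 < x.2} :=
    isOpen_lt (by fun_prop) (by fun_prop)
  have h3 : IsOpen {x : ℝ × ℝ | x.2 < p.2 + r x.1} :=
    isOpen_lt (by fun_prop) (by fun_prop)
  exact h1.inter (h2.inter h3)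

lemma fan_subset_closedFan : fan l r p t₀ t₁ ⊆ closedFan l r p t₀ t₁ :=
  fun _ hx => ⟨Ioo_subset_Icc_self hx.1, Ioo_subset_Icc_self hx.2⟩

/-- Straightening each vertical section affinely yields both compactness and, by restricting to the
open rectangle, density of the open fan in the closed one. -/
lemma closedFan_eq_image (h : ∀ t ∈ Icc t₀ t₁, 0 < l t + r t) :
    closedFan l r p t₀ t₁ =
      (fun z : ℝ × ℝ => (z.1, p.2 - l z.1 + z.2 * (l z.1 + r z.1))) '' Icc t₀ t₁ ×ˢ Icc 0 1 := by
  ext x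
  constructor
  · rintro ⟨h1, h2, h3⟩
    have := h _ h1
    refine ⟨(x.1, (x.2 - (p.2 - l x.1)) / (l x.1 + r x.1)), ⟨h1, ?_, ?_⟩, ?_⟩
    · exact div_nonneg (by linarith) this.le
    · rw [div_le_one this]; linarith
    · ext
      · rfl
      · simp only
        field_simp
        ring
  · rintro ⟨z, ⟨h1, h2, h3⟩, rfl⟩
    have := h _ h1
    refine ⟨h1, ?_, ?_⟩ <;> simp only
    · nlinarith
    · nlinarith

lemma isCompact_closedFan (hl : Continuous l) (hr : Continuous r)
    (h : ∀ t ∈ Icc t₀ t₁, 0 < l t + r t) : IsCompact (closedFan l r p t₀ t₁) := by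
  rw [closedFan_eq_image h]
  exact (isCompact_Icc.prod isCompact_Icc).image (by fun_prop)

lemma closure_fan (hl : Continuous l) (hr : Continuous r) (ht : t₀ < t₁)
    (h : ∀ t ∈ Icc t₀ t₁, 0 < l t + r t) :
    closure (fan l r p t₀ t₁) = closedFan l r p t₀ t₁ := by
  refine (closure_minimal fan_subset_closedFan (isCompact_closedFan hl hr h).isClosed).antisymm ?_
  rw [closedFan_eq_image h, ← closure_Ioo ht.ne, ← closure_Ioo (zero_ne_one (α := ℝ)),
    ← closure_prod_eq]
  refine (image_closure_subset_closure_image (by fun_prop)).trans (closure_mono ?_)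
  rintro _ ⟨z, ⟨h1, h2, h3⟩, rfl⟩
  have := h _ (Ioo_subset_Icc_self h1)
  refine ⟨h1, ?_, ?_⟩ <;> simp only
  · nlinarith
  · nlinarith

lemma volume_regionBetween_Ioo {f g : ℝ → ℝ} (hf : Continuous f) (hg : Continuous g) (ht : t₀ ≤ t₁)
    (hfg : ∀ t ∈ Ioo t₀ t₁, f t ≤ g t) :
    volume (regionBetween f g (Ioo t₀ t₁)) = ENNReal.ofReal (∫ t in t₀..t₁, (g t - f t)) := by
  have hi : ∀ {u : ℝ → ℝ}, Continuous u → IntegrableOn u (Ioo t₀ t₁) := fun hu =>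
    (hu.continuousOn.integrableOn_compact isCompact_Icc).mono_set Ioo_subset_Icc_self
  rw [Measure.volume_eq_prod,
    volume_regionBetween_eq_integral (hi hf) (hi hg) measurableSet_Ioo hfg,
    intervalIntegral.integral_of_le ht, integral_Ioc_eq_integral_Ioo]
  rfl

/-- By Fubini: vertical sections differ only in their endpoints, except over the two values `t₀` and
`t₁`. -/
lemma volume_closedFan (hl : Continuous l) (hr : Continuous r) :
    volume (closedFan l r p t₀ t₁) = volume (fan l r p t₀ t₁) := by
  have hm : MeasurableSet (closedFan l r p t₀ t₁) :=
    measurableSet_region_between_cc (measurable_const.sub hl.measurable)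
      (measurable_const.add hr.measurable) measurableSet_Icc
  rw [Measure.volume_eq_prod, Measure.prod_apply hm,
    Measure.prod_apply (isOpen_fan hl hr).measurableSet]
  have hne : ∀ a : ℝ, ∀ᵐ t : ℝ, t ≠ a := fun a => by simp [ae_iff]
  refine lintegral_congr_ae ?_
  filter_upwards [hne t₀, hne t₁] with t h0 h1
  by_cases h : t ∈ Ioo t₀ t₁
  · have e1 : Prod.mk t ⁻¹' closedFan l r p t₀ t₁ = Icc (p.2 - l t) (p.2 + r t) := by
      ext s; exact ⟨fun hs => hs.2, fun hs => ⟨Ioo_subset_Icc_self h, hs⟩⟩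
    have e2 : Prod.mk t ⁻¹' fan l r p t₀ t₁ = Ioo (p.2 - l t) (p.2 + r t) := by
      ext s; exact ⟨fun hs => hs.2, fun hs => ⟨h, hs⟩⟩
    rw [e1, e2, Real.volume_Icc, Real.volume_Ioo]
  · have e1 : Prod.mk t ⁻¹' closedFan l r p t₀ t₁ = ∅ := by
      ext s
      simp only [mem_preimage, mem_empty_iff_false, iff_false]
      exact fun hs => h ⟨lt_of_le_of_ne hs.1.1 (Ne.symm h0), lt_of_le_of_ne hs.1.2 h1⟩
    have e2 : Prod.mk t ⁻¹' fan l r p t₀ t₁ = ∅ := by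
      ext s
      simp only [mem_preimage, mem_empty_iff_false, iff_false]
      exact fun hs => h hs.1
    rw [e1, e2]

lemma volume_fan (hl : Continuous l) (hr : Continuous r) (ht : t₀ ≤ t₁)
    (h : ∀ t ∈ Icc t₀ t₁, 0 < l t + r t) :
    volume (fan l r p t₀ t₁) = ENNReal.ofReal (∫ t in t₀..t₁, (l t + r t)) := by
  rw [fan, volume_regionBetween_Ioo (by fun_prop) (by fun_prop) ht]
  · congr 2; ext t; ring
  · intro t ht'; linarith [h t (Ioo_subset_Icc_self ht')]

/-- A fan in which `p` halves the area in both coordinate directions has `p` as optimal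
location. -/
lemma setIntegral_manhattanDist_fan_le (hl : Continuous l) (hr : Continuous r)
    (h0 : t₀ < p.1) (h1 : p.1 < t₁) (hlpos : ∀ t ∈ Icc t₀ t₁, 0 < l t)
    (hrpos : ∀ t ∈ Icc t₀ t₁, 0 < r t) (hlr : ∫ t in t₀..t₁, l t = ∫ t in t₀..t₁, r t)
    (hmed : ∫ t in t₀..p.1, (l t + r t) = ∫ t in p.1..t₁, (l t + r t)) (q : ℝ × ℝ) :
    ∫ x in fan l r p t₀ t₁, manhattanDist x p ≤ ∫ x in fan l r p t₀ t₁, manhattanDist x q := by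
  have hpos : ∀ t ∈ Icc t₀ t₁, 0 < l t + r t := fun t ht => add_pos (hlpos t ht) (hrpos t ht)
  have hm : MeasurableSet (fan l r p t₀ t₁) := (isOpen_fan hl hr).measurableSet
  have hc := isCompact_closedFan (p := p) hl hr hpos
  have hfin : volume (fan l r p t₀ t₁) ≠ ⊤ :=
    ((measure_mono fan_subset_closedFan).trans_lt hc.measure_lt_top).ne
  have hint : ∀ f : ℝ × ℝ → ℝ, Continuous f → IntegrableOn f (fan l r p t₀ t₁) := fun f hf =>
    (hf.continuousOn.integrableOn_compact hc).mono_set fan_subset_closedFan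
  have i1 : ∀ c : ℝ, IntegrableOn (fun x : ℝ × ℝ => |x.1 - c|) (fan l r p t₀ t₁) :=
    fun c => hint _ (by fun_prop)
  have i2 : ∀ c : ℝ, IntegrableOn (fun x : ℝ × ℝ => |x.2 - c|) (fan l r p t₀ t₁) :=
    fun c => hint _ (by fun_prop)
  have m1 := setIntegral_abs_sub_le hfin continuous_fst i1 (p := p.1) (by
    have e1 : fan l r p t₀ t₁ ∩ {x | x.1 < p.1} = fan l r p t₀ p.1 := by
      ext x
      refine ⟨fun hx => ⟨⟨hx.1.1.1, hx.2⟩, hx.1.2⟩, fun hx => ⟨⟨⟨hx.1.1, ?_⟩, hx.2⟩, hx.1.2⟩⟩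
      exact hx.1.2.trans h1
    have e2 : fan l r p t₀ t₁ ∩ {x | p.1 < x.1} = fan l r p p.1 t₁ := by
      ext x
      refine ⟨fun hx => ⟨⟨hx.2, hx.1.1.2⟩, hx.1.2⟩, fun hx => ⟨⟨⟨?_, hx.1.2⟩, hx.2⟩, hx.1.1⟩⟩
      exact h0.trans hx.1.1
    rw [e1, e2, volume_fan hl hr h0.le, volume_fan hl hr h1.le, hmed]
    · exact fun t ht => hpos t ⟨h0.le.trans ht.1, ht.2⟩
    · exact fun t ht => hpos t ⟨ht.1, ht.2.trans h1.le⟩) q.1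
  have m2 := setIntegral_abs_sub_le hfin continuous_snd i2 (p := p.2) (by
    have e1 : fan l r p t₀ t₁ ∩ {x | x.2 < p.2} =
        regionBetween (fun t => p.2 - l t) (fun _ => p.2) (Ioo t₀ t₁) := by
      ext x
      refine ⟨fun hx => ⟨hx.1.1, hx.1.2.1, hx.2⟩, fun hx => ⟨⟨hx.1, hx.2.1, ?_⟩, hx.2.2⟩⟩
      have := hrpos _ (Ioo_subset_Icc_self hx.1)
      have := hx.2.2
      simp only at this ⊢
      linarith
    have e2 : fan l r p t₀ t₁ ∩ {x | p.2 < x.2} =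
        regionBetween (fun _ => p.2) (fun t => p.2 + r t) (Ioo t₀ t₁) := by
      ext x
      refine ⟨fun hx => ⟨hx.1.1, hx.2, hx.1.2.2⟩, fun hx => ⟨⟨hx.1, ?_, hx.2.2⟩, hx.2.1⟩⟩
      have := hlpos _ (Ioo_subset_Icc_self hx.1)
      have := hx.2.1
      simp only at this ⊢
      linarith
    rw [e1, e2, volume_regionBetween_Ioo (by fun_prop) (by fun_prop) (h0.trans h1).le,
      volume_regionBetween_Ioo (by fun_prop) (by fun_prop) (h0.trans h1).le]
    · simp [hlr]
    · intro t ht; linarith [hrpos t (Ioo_subset_Icc_self ht)]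
    · intro t ht; linarith [hlpos t (Ioo_subset_Icc_self ht)]) q.2
  simp only [manhattanDist]
  rw [integral_add (i1 _) (i2 _), integral_add (i1 _) (i2 _)]
  exact add_le_add m1 m2

/-! ### Cores: handling cells up to their boundary -/

/-- `V` is, up to its boundary, an open non-rectangular region of area `A` for which `p` is an
optimal location. -/
def HasCore (A : ℝ) (p : ℝ × ℝ) (V : Set (ℝ × ℝ)) : Prop :=
  ∃ U, IsOpen U ∧ U ⊆ V ∧ V ⊆ closure U ∧ volume U = ENNReal.ofReal A ∧
    volume (closure U) = ENNReal.ofReal A ∧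
    (∀ q, ∫ x in U, manhattanDist x p ≤ ∫ x in U, manhattanDist x q) ∧ ¬ IsRectangle U

namespace HasCore

variable {A : ℝ} {V : Set (ℝ × ℝ)}

lemma volume_eq (h : HasCore A p V) : volume V = ENNReal.ofReal A := by
  obtain ⟨U, -, h1, h2, h3, h4, -⟩ := h
  exact le_antisymm (h4 ▸ measure_mono h2) (h3 ▸ measure_mono h1)

lemma not_isRectangle (h : HasCore A p V) : ¬ IsRectangle V := by
  obtain ⟨U, -, h1, h2, -, -, -, h⟩ := h
  have : closure V = closure U := (closure_minimal h2 isClosed_closure).antisymm (closure_mono h1)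
  rwa [IsRectangle, this]

/-- The core and its closure have the same finite area, so `V` differs from the core by a null set
and the two averages agree. -/
lemma setAverage_le (h : HasCore A p V) (q : ℝ × ℝ) :
    (⨍ x in V, manhattanDist x p) ≤ ⨍ x in V, manhattanDist x q := by
  obtain ⟨U, ho, h1, h2, h3, h4, h5, -⟩ := h
  have hle : volume V ≤ volume U := by rw [h3, ← h4]; exact measure_mono h2
  have hae : U =ᵐ[volume] V := ae_eq_of_subset_of_measure_ge h1 hle
    ho.measurableSet.nullMeasurableSet
    ((measure_mono h2).trans_lt (by rw [h4]; exact ENNReal.ofReal_lt_top)).ne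
  rw [← setAverage_congr hae, ← setAverage_congr hae, setAverage_eq, setAverage_eq]
  exact smul_le_smul_of_nonneg_left (h5 q) (inv_nonneg.2 measureReal_nonneg)

end HasCore

/-- A fan whose total width is not concave is no rectangle. -/
lemma not_isRectangle_fan_of_width (hl : Continuous l) (hr : Continuous r) (ht : t₀ < t₁)
    (hpos : ∀ t ∈ Icc t₀ t₁, 0 < l t + r t) {s t : ℝ} (hs : s ∈ Icc t₀ t₁) (ht' : t ∈ Icc t₀ t₁)
    (h : l ((s + t) / 2) + r ((s + t) / 2) < ((l s + r s) + (l t + r t)) / 2) :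
    ¬ IsRectangle (fan l r p t₀ t₁) := by
  intro hR
  have hc := hR.convex_closure
  rw [closure_fan hl hr ht hpos] at hc
  have a1 : ((s, p.2 - l s) : ℝ × ℝ) ∈ closedFan l r p t₀ t₁ :=
    ⟨hs, le_rfl, by have := hpos s hs; simp only; linarith⟩
  have a2 : ((s, p.2 + r s) : ℝ × ℝ) ∈ closedFan l r p t₀ t₁ :=
    ⟨hs, by have := hpos s hs; simp only; linarith, le_rfl⟩
  have b1 : ((t, p.2 - l t) : ℝ × ℝ) ∈ closedFan l r p t₀ t₁ :=
    ⟨ht', le_rfl, by have := hpos t ht'; simp only; linarith⟩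
  have b2 : ((t, p.2 + r t) : ℝ × ℝ) ∈ closedFan l r p t₀ t₁ :=
    ⟨ht', by have := hpos t ht'; simp only; linarith, le_rfl⟩
  -- By convexity, the midpoints of the two lower ends and of the two upper ends lie in the section
  -- over the midpoint; together they bound its width from below.
  have c1 := (hc a1 b1 (by norm_num : (0 : ℝ) ≤ 1 / 2) (by norm_num : (0 : ℝ) ≤ 1 / 2)
    (by norm_num)).2.1
  have c2 := (hc a2 b2 (by norm_num : (0 : ℝ) ≤ 1 / 2) (by norm_num : (0 : ℝ) ≤ 1 / 2)
    (by norm_num)).2.2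
  simp only [Prod.smul_mk, Prod.mk_add_mk, smul_eq_mul] at c1 c2
  rw [show 1 / 2 * s + 1 / 2 * t = (s + t) / 2 by ring] at c1 c2
  linarith

/-- A fan that is not centrally symmetric is no rectangle. -/
lemma not_isRectangle_fan_of_asymm (hl : Continuous l) (hr : Continuous r) (ht : t₀ < t₁)
    (hpos : ∀ t ∈ Icc t₀ t₁, 0 < l t + r t) {s t : ℝ} (hs : s ∈ Icc t₀ t₁) (ht' : t ∈ Icc t₀ t₁)
    (h : r s - l (t₀ + t₁ - s) ≠ r t - l (t₀ + t₁ - t)) :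
    ¬ IsRectangle (fan l r p t₀ t₁) := by
  intro hR
  obtain ⟨c, hc⟩ := hR.symmetric_closure
  rw [closure_fan hl hr ht hpos] at hc
  have lo : ∀ t ∈ Icc t₀ t₁, ((t, p.2 - l t) : ℝ × ℝ) ∈ closedFan l r p t₀ t₁ := fun t ht =>
    ⟨ht, le_rfl, by have := hpos t ht; simp only; linarith⟩
  have hi : ∀ t ∈ Icc t₀ t₁, ((t, p.2 + r t) : ℝ × ℝ) ∈ closedFan l r p t₀ t₁ := fun t ht =>
    ⟨ht, by have := hpos t ht; simp only; linarith, le_rfl⟩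
  have d0 := (hc _ (lo t₀ ⟨le_rfl, ht.le⟩)).1
  have d1 := (hc _ (lo t₁ ⟨ht.le, le_rfl⟩)).1
  -- The reflection preserves the range of first coordinates, hence swaps its ends.
  have hc1 : c.1 = t₀ + t₁ := le_antisymm (by have := d0.2; simp at this; linarith)
    (by have := d1.1; simp at this; linarith)
  -- Upper ends are sent weakly above lower ends and lower ends weakly below upper ends, which
  -- forces equality.
  have key : ∀ t ∈ Icc t₀ t₁, r t - l (t₀ + t₁ - t) = c.2 - p.2 - p.2 := by
    intro t ht
    have ht2 : t₀ + t₁ - t ∈ Icc t₀ t₁ := ⟨by linarith [ht.2], by linarith [ht.1]⟩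
    have u := (hc _ (hi t ht)).2.1
    have v := (hc _ (lo _ ht2)).2.2
    simp only [Prod.fst_sub, Prod.snd_sub, hc1, sub_sub_cancel] at u v
    linarith
  exact h ((key s hs).trans (key t ht').symm)

/-- The data of a fan that make it the core of a Voronoi cell. -/
lemma hasCore_of_fan {A : ℝ} {V : Set (ℝ × ℝ)} (hl : Continuous l) (hr : Continuous r)
    (h0 : t₀ < p.1) (h1 : p.1 < t₁) (hlpos : ∀ t ∈ Icc t₀ t₁, 0 < l t)
    (hrpos : ∀ t ∈ Icc t₀ t₁, 0 < r t) {L₁ L₂ R₁ R₂ : ℝ}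
    (hL₁ : ∫ t in t₀..p.1, l t = L₁) (hL₂ : ∫ t in p.1..t₁, l t = L₂)
    (hR₁ : ∫ t in t₀..p.1, r t = R₁) (hR₂ : ∫ t in p.1..t₁, r t = R₂)
    (hL : L₁ + L₂ = A / 2) (hR : R₁ + R₂ = A / 2) (hLR : L₁ + R₁ = A / 2)
    (hsub : fan l r p t₀ t₁ ⊆ V) (hsup : V ⊆ closedFan l r p t₀ t₁)
    (hrect : ¬ IsRectangle (fan l r p t₀ t₁)) : HasCore A p V := by
  have hpos : ∀ t ∈ Icc t₀ t₁, 0 < l t + r t := fun t ht => add_pos (hlpos t ht) (hrpos t ht)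
  have ht := h0.trans h1
  have il : ∀ a b : ℝ, IntervalIntegrable l volume a b := fun a b => hl.intervalIntegrable a b
  have ir : ∀ a b : ℝ, IntervalIntegrable r volume a b := fun a b => hr.intervalIntegrable a b
  have sl : ∫ t in t₀..t₁, l t = L₁ + L₂ := by
    rw [← hL₁, ← hL₂, intervalIntegral.integral_add_adjacent_intervals (il _ _) (il _ _)]
  have sr : ∫ t in t₀..t₁, r t = R₁ + R₂ := by
    rw [← hR₁, ← hR₂, intervalIntegral.integral_add_adjacent_intervals (ir _ _) (ir _ _)]
  have hcl := closure_fan (p := p) hl hr ht hpos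
  have hv : volume (fan l r p t₀ t₁) = ENNReal.ofReal A := by
    rw [volume_fan hl hr ht.le hpos, intervalIntegral.integral_add (il _ _) (ir _ _), sl, sr]
    congr 1; linarith
  refine ⟨fan l r p t₀ t₁, isOpen_fan hl hr, hsub, hcl ▸ hsup, hv, ?_, ?_, hrect⟩
  · rw [hcl, volume_closedFan hl hr, hv]
  · refine setIntegral_manhattanDist_fan_le hl hr h0 h1 hlpos hrpos (by linarith) ?_
    rw [intervalIntegral.integral_add (il _ _) (ir _ _),
      intervalIntegral.integral_add (il _ _) (ir _ _)]
    linarith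

lemma mem_voronoiCell {R : Set (ℝ × ℝ)} {P : Finset (ℝ × ℝ)} {p x : ℝ × ℝ} :
    x ∈ voronoiCell R P p ↔
      x ∈ R ∧ ∀ q ∈ P, q ≠ p → manhattanDist x p < manhattanDist x q := by
  simp only [voronoiCell, dominance, mem_inter_iff, mem_iInter, mem_sdiff, Finset.mem_coe,
    mem_singleton_iff, mem_ofPred_eq]
  exact ⟨fun h => ⟨h.1, fun q hq hqp => (h.2 q ⟨hq, hqp⟩).2⟩,
    fun h => ⟨h.1, fun q hq => ⟨h.1, h.2 q hq.1 hq.2⟩⟩⟩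

/-- Gluing changes a cell only on the common edge; an open core already lies in the interior and is
unaffected. -/
lemma HasCore.of_interior_subset {A : ℝ} {p : ℝ × ℝ} {V W : Set (ℝ × ℝ)} (h : HasCore A p V)
    (hWV : W ⊆ V) (hVW : interior V ⊆ W) : HasCore A p W := by
  obtain ⟨U, ho, h1, h2, h3⟩ := h
  exact ⟨U, ho, (interior_maximal h1 ho).trans hVW, hWV.trans h2, h3⟩

/-! ### Stacking strips -/

/-- A point set in the strip rectangle `[-H, H] × [a, b]` all of whose Voronoi cells have a core of
area `A`, and whose Manhattan distances from the edges `[-H, H] × {a}` and `[-H, H] × {b}` are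
given by the profiles `f` and `g`. -/
structure StripConfig (H A a b : ℝ) (f g : ℝ → ℝ) (P : Finset (ℝ × ℝ)) : Prop where
  lt : a < b
  mem : ∀ p ∈ P, p.1 ∈ Icc (-H) H ∧ p.2 ∈ Ioo a b
  core : ∀ p ∈ P, HasCore A p (voronoiCell (Icc (-H, a) (H, b)) P p)
  bot_le : ∀ t ∈ Icc (-H) H, ∀ p ∈ P, f t ≤ |t - p.1| + (p.2 - a)
  bot_ex : ∀ t ∈ Icc (-H) H, ∃ p ∈ P, |t - p.1| + (p.2 - a) = f t
  top_le : ∀ t ∈ Icc (-H) H, ∀ p ∈ P, g t ≤ |t - p.1| + (b - p.2)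
  top_ex : ∀ t ∈ Icc (-H) H, ∃ p ∈ P, |t - p.1| + (b - p.2) = g t

namespace StripConfig

variable {H A a b c : ℝ} {f g h : ℝ → ℝ} {P Q : Finset (ℝ × ℝ)}

lemma disjoint (hP : StripConfig H A a b f g P) (hQ : StripConfig H A b c g h Q) :
    Disjoint P Q :=
  Finset.disjoint_left.2 fun p hp hq => by linarith [(hP.mem p hp).2.2, (hQ.mem p hq).2.1]

/-- Two configurations with the same profile on their common edge can be glued. -/
lemma glue (hP : StripConfig H A a b f g P) (hQ : StripConfig H A b c g h Q) :
    StripConfig H A a c f h (P ∪ Q) := by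
  have hab := hP.lt
  have hbc := hQ.lt
  refine ⟨hab.trans hbc, ?_, ?_, ?_, ?_, ?_, ?_⟩
  · intro p hp
    rcases Finset.mem_union.1 hp with hp | hp
    · exact ⟨(hP.mem p hp).1, (hP.mem p hp).2.1, (hP.mem p hp).2.2.trans hbc⟩
    · exact ⟨(hQ.mem p hp).1, hab.trans (hQ.mem p hp).2.1, (hQ.mem p hp).2.2⟩
  · intro p hp
    rcases Finset.mem_union.1 hp with hp | hp
    · refine (hP.core p hp).of_interior_subset ?_ ?_
      · intro x hx
        rw [mem_voronoiCell] at hx ⊢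
        refine ⟨⟨hx.1.1, hx.1.2.1, ?_⟩, fun q hq => hx.2 q (Finset.mem_union_left _ hq)⟩
        -- At height `b` or above, every point of `P` is at distance at least `g x.1 + (x.2 - b)`,
        -- and the point of `Q` realising the profile at `x.1` is no farther than that.
        by_contra! hb
        simp only at hb
        have ht : x.1 ∈ Icc (-H) H := ⟨hx.1.1.1, hx.1.2.1⟩
        obtain ⟨q, hq, hqe⟩ := hQ.bot_ex _ ht
        have hlt := hx.2 q (Finset.mem_union_right _ hq) (by
          rintro rfl; linarith [(hP.mem _ hp).2.2, (hQ.mem _ hq).2.1])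
        have hle := hP.top_le _ ht p hp
        simp only [manhattanDist] at hlt
        have := (hQ.mem q hq).2.1
        have := (hP.mem p hp).2.2
        rw [abs_of_pos (by linarith : 0 < x.2 - p.2)] at hlt
        have : |x.2 - q.2| ≤ (x.2 - b) + (q.2 - b) := abs_le.2 ⟨by linarith, by linarith⟩
        linarith
      · intro x hx
        -- Openness of the projection keeps interior points off the common edge.
        have hb : x.2 < b := by
          have h1 : voronoiCell (Icc (-H, a) (H, b)) P p ⊆ Prod.snd ⁻¹' Iic b :=
            fun y hy => (mem_voronoiCell.1 hy).1.2.2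
          have h2 := interior_mono h1 hx
          rwa [← isOpenMap_snd.preimage_interior_eq_interior_preimage continuous_snd,
            interior_Iic] at h2
        have hx' := mem_voronoiCell.1 (interior_subset hx)
        have ht : x.1 ∈ Icc (-H) H := ⟨hx'.1.1.1, hx'.1.2.1⟩
        refine mem_voronoiCell.2 ⟨⟨hx'.1.1, hx'.1.2.1, hb.le.trans hbc.le⟩, fun q hq hqp => ?_⟩
        rcases Finset.mem_union.1 hq with hq | hq
        · exact hx'.2 q hq hqp
        -- Strictly below the edge, the point `p'` of `P` realising the profile at `x.1` beats all
        -- of `Q`, and `p` is at least as close as `p'`.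
        · obtain ⟨p', hp', he⟩ := hP.top_ex _ ht
          have h1 : manhattanDist x p ≤ manhattanDist x p' := by
            by_cases h : p' = p
            · rw [h]
            · exact (hx'.2 p' hp' h).le
          refine h1.trans_lt ?_
          have hle := hQ.bot_le _ ht q hq
          simp only [manhattanDist]
          have := (hQ.mem q hq).2.1
          have := (hP.mem p' hp').2.2
          rw [abs_of_neg (by linarith : x.2 - q.2 < 0)]
          have : |x.2 - p'.2| < (b - x.2) + (b - p'.2) := abs_lt.2 ⟨by linarith, by linarith⟩
          linarith
    · refine (hQ.core p hp).of_interior_subset ?_ ?_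
      · intro x hx
        rw [mem_voronoiCell] at hx ⊢
        refine ⟨⟨⟨hx.1.1.1, ?_⟩, hx.1.2⟩, fun q hq => hx.2 q (Finset.mem_union_right _ hq)⟩
        by_contra! hb
        simp only at hb
        have ht : x.1 ∈ Icc (-H) H := ⟨hx.1.1.1, hx.1.2.1⟩
        obtain ⟨q, hq, hqe⟩ := hP.top_ex _ ht
        have hlt := hx.2 q (Finset.mem_union_left _ hq) (by
          rintro rfl; linarith [(hQ.mem _ hp).2.1, (hP.mem _ hq).2.2])
        have hle := hQ.bot_le _ ht p hp
        simp only [manhattanDist] at hlt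
        have := (hP.mem q hq).2.2
        have := (hQ.mem p hp).2.1
        rw [abs_of_neg (by linarith : x.2 - p.2 < 0)] at hlt
        have : |x.2 - q.2| ≤ (b - x.2) + (b - q.2) := abs_le.2 ⟨by linarith, by linarith⟩
        linarith
      · intro x hx
        have hb : b < x.2 := by
          have h1 : voronoiCell (Icc (-H, b) (H, c)) Q p ⊆ Prod.snd ⁻¹' Ici b :=
            fun y hy => (mem_voronoiCell.1 hy).1.1.2
          have h2 := interior_mono h1 hx
          rwa [← isOpenMap_snd.preimage_interior_eq_interior_preimage continuous_snd,
            interior_Ici] at h2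
        have hx' := mem_voronoiCell.1 (interior_subset hx)
        have ht : x.1 ∈ Icc (-H) H := ⟨hx'.1.1.1, hx'.1.2.1⟩
        refine mem_voronoiCell.2 ⟨⟨⟨hx'.1.1.1, hab.le.trans hb.le⟩, hx'.1.2⟩, fun q hq hqp => ?_⟩
        rcases Finset.mem_union.1 hq with hq | hq
        · obtain ⟨p', hp', he⟩ := hQ.bot_ex _ ht
          have h1 : manhattanDist x p ≤ manhattanDist x p' := by
            by_cases h : p' = p
            · rw [h]
            · exact (hx'.2 p' hp' h).le
          refine h1.trans_lt ?_
          have hle := hP.top_le _ ht q hq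
          simp only [manhattanDist]
          have := (hP.mem q hq).2.2
          have := (hQ.mem p' hp').2.1
          rw [abs_of_pos (by linarith : 0 < x.2 - q.2)]
          have : |x.2 - p'.2| < (x.2 - b) + (p'.2 - b) := abs_lt.2 ⟨by linarith, by linarith⟩
          linarith
        · exact hx'.2 q hq hqp
  · intro t ht p hp
    rcases Finset.mem_union.1 hp with hp | hp
    · exact hP.bot_le t ht p hp
    -- Seen from the lower edge, a point of `Q` is farther than the point of `P` realising the
    -- common profile above `t`, so the lower profile is unchanged.
    · obtain ⟨q, hq, he⟩ := hP.top_ex t ht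
      linarith [hP.bot_le t ht q hq, hQ.bot_le t ht p hp, (hP.mem q hq).2.2]
  · intro t ht
    obtain ⟨p, hp, he⟩ := hP.bot_ex t ht
    exact ⟨p, Finset.mem_union_left _ hp, he⟩
  · intro t ht p hp
    rcases Finset.mem_union.1 hp with hp | hp
    · obtain ⟨q, hq, he⟩ := hQ.bot_ex t ht
      linarith [hQ.top_le t ht q hq, hP.top_le t ht p hp, (hQ.mem q hq).2.1]
    · exact hQ.top_le t ht p hp
  · intro t ht
    obtain ⟨p, hp, he⟩ := hQ.top_ex t ht
    exact ⟨p, Finset.mem_union_right _ hp, he⟩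

lemma exists_rectangle (hP : StripConfig H A a b f g P) (hH : 0 < H) :
    ∃ (a b : ℝ × ℝ) (P' : Finset (ℝ × ℝ)), a.1 < b.1 ∧ a.2 < b.2 ∧
      (P' : Set (ℝ × ℝ)) ⊆ Icc a b ∧ P'.card = P.card ∧ Balanced (Icc a b) P' ∧
      ∀ p ∈ P', ¬ IsRectangle (voronoiCell (Icc a b) P' p) := by
  refine ⟨(-H, a), (H, b), P, by simp only; linarith, hP.lt, fun p hp => ?_, rfl, ⟨?_, ?_⟩, ?_⟩
  · have := hP.mem p hp
    exact ⟨⟨this.1.1, this.2.1.le⟩, this.1.2, this.2.2.le⟩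
  · intro p hp q hq
    rw [(hP.core p hp).volume_eq, (hP.core q hq).volume_eq]
  · exact fun p hp => (hP.core p hp).setAverage_le
  · exact fun p hp => (hP.core p hp).not_isRectangle

end StripConfig

/-! ### Piecewise linear reaches and their quadrant areas -/

lemma intervalIntegral_eq_of_linear {f : ℝ → ℝ} {a b : ℝ} (α β : ℝ) (hab : a ≤ b)
    (h : ∀ t ∈ Icc a b, f t = α + β * t) :
    ∫ t in a..b, f t = α * (b - a) + β * ((b ^ 2 - a ^ 2) / 2) := by
  rw [intervalIntegral.integral_congr (g := fun t => α + β * t)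
    fun t ht => h t (by rwa [uIcc_of_le hab] at ht),
    intervalIntegral.integral_add (by simp)
      ((by fun_prop : Continuous fun t : ℝ => β * t).intervalIntegrable _ _),
    intervalIntegral.integral_const_mul]
  simp [integral_id]
  ring

/-- Distance of a single to the bisector with a neighbouring pair. -/
noncomputable def singleReach (t : ℝ) : ℝ := max 2 (16 - |t|)

/-- Distance of a pair to the bisector with a neighbouring single. -/
noncomputable def pairReach (t : ℝ) : ℝ := min 16 (2 + |t|)

lemma continuous_singleReach : Continuous singleReach := by unfold singleReach; fun_prop

lemma continuous_pairReach : Continuous pairReach := by unfold pairReach; fun_prop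

lemma integral_singleReach_pos : ∫ t in (0 : ℝ)..(49 / 2), singleReach t = 147 := by
  have i : ∀ a b : ℝ, IntervalIntegrable singleReach volume a b :=
    fun a b => continuous_singleReach.intervalIntegrable a b
  rw [← intervalIntegral.integral_add_adjacent_intervals (i 0 14) (i 14 _),
    intervalIntegral_eq_of_linear 16 (-1) (by norm_num),
    intervalIntegral_eq_of_linear 2 0 (by norm_num)]
  · norm_num
  · rintro t ⟨h1, h2⟩; grind [singleReach]
  · rintro t ⟨h1, h2⟩; grind [singleReach]

lemma integral_singleReach_neg : ∫ t in (-(49 / 2) : ℝ)..0, singleReach t = 147 := by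
  have i : ∀ a b : ℝ, IntervalIntegrable singleReach volume a b :=
    fun a b => continuous_singleReach.intervalIntegrable a b
  rw [← intervalIntegral.integral_add_adjacent_intervals (i _ (-14)) (i (-14) _),
    intervalIntegral_eq_of_linear 2 0 (by norm_num),
    intervalIntegral_eq_of_linear 16 1 (by norm_num)]
  · norm_num
  · rintro t ⟨h1, h2⟩; grind [singleReach]
  · rintro t ⟨h1, h2⟩; grind [singleReach]

lemma integral_pairReach_inner : ∫ t in (0 : ℝ)..14, pairReach t = 126 := by
  rw [intervalIntegral_eq_of_linear 2 1 (by norm_num)]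
  · norm_num
  · rintro t ⟨h1, h2⟩; grind [pairReach]

lemma integral_pairReach_outer : ∫ t in (14 : ℝ)..(49 / 2), pairReach t = 168 := by
  rw [intervalIntegral_eq_of_linear 16 0 (by norm_num)]
  · norm_num
  · rintro t ⟨h1, h2⟩; grind [pairReach]

lemma integral_pairReach_neg_inner : ∫ t in (-14 : ℝ)..0, pairReach t = 126 := by
  rw [intervalIntegral_eq_of_linear 2 (-1) (by norm_num)]
  · norm_num
  · rintro t ⟨h1, h2⟩; grind [pairReach]

lemma integral_pairReach_neg_outer : ∫ t in (-(49 / 2) : ℝ)..(-14), pairReach t = 168 := by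
  rw [intervalIntegral_eq_of_linear 16 0 (by norm_num)]
  · norm_num
  · rintro t ⟨h1, h2⟩; grind [pairReach]

lemma singleReach_pos (t : ℝ) : 0 < singleReach t :=
  lt_of_lt_of_le two_pos (le_max_left _ _)

lemma pairReach_pos (t : ℝ) : 0 < pairReach t :=
  lt_min (by norm_num) (by positivity)

/-- The possible reaches of a single: to a mirror line or to a neighbouring pair. -/
def IsSingleReach (l : ℝ → ℝ) : Prop := l = (fun _ => 6) ∨ l = singleReach

lemma IsSingleReach.facts {l : ℝ → ℝ} (h : IsSingleReach l) :
    Continuous l ∧ (∀ t, 0 < l t) ∧ ∫ t in (-(49 / 2) : ℝ)..0, l t = 147 ∧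
      ∫ t in (0 : ℝ)..(49 / 2), l t = 147 ∧ l 10 = 6 := by
  rcases h with rfl | rfl
  · refine ⟨continuous_const, fun _ => by norm_num, ?_, ?_, rfl⟩ <;> norm_num
  · refine ⟨continuous_singleReach, singleReach_pos, integral_singleReach_neg,
      integral_singleReach_pos, ?_⟩
    grind [singleReach]

/-- Distance to the bisector of `(-1, v)` and `(1, v + 4)`, measured down from the latter. -/
noncomputable def skewReach (t : ℝ) : ℝ := 2 + max (-1) (min 1 t)

lemma continuous_skewReach : Continuous skewReach := by unfold skewReach; fun_prop

lemma skewReach_pos (t : ℝ) : 0 < skewReach t := by grind [skewReach]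

lemma integral_skewReach_left : ∫ t in (-5 : ℝ)..1, skewReach t = 8 := by
  have i : ∀ a b : ℝ, IntervalIntegrable skewReach volume a b :=
    fun a b => continuous_skewReach.intervalIntegrable a b
  rw [← intervalIntegral.integral_add_adjacent_intervals (i _ (-1)) (i (-1) _),
    intervalIntegral_eq_of_linear 1 0 (by norm_num),
    intervalIntegral_eq_of_linear 2 1 (by norm_num)]
  · norm_num
  · rintro t ⟨h1, h2⟩; grind [skewReach]
  · rintro t ⟨h1, h2⟩; grind [skewReach]

lemma integral_skewReach_right : ∫ t in (1 : ℝ)..5, skewReach t = 12 := by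
  rw [intervalIntegral_eq_of_linear 3 0 (by norm_num)]
  · norm_num
  · rintro t ⟨h1, h2⟩; grind [skewReach]

lemma integral_skewReach_neg_left : ∫ t in (-5 : ℝ)..(-1), skewReach (-t) = 12 := by
  rw [intervalIntegral.integral_comp_neg skewReach]
  simpa using integral_skewReach_right

lemma integral_skewReach_neg_right : ∫ t in (-1 : ℝ)..5, skewReach (-t) = 8 := by
  rw [intervalIntegral.integral_comp_neg skewReach]
  simpa using integral_skewReach_left

/-! ### Cells of singles and pairs, and the bricks built from them -/

variable {c : ℝ} {V : Set (ℝ × ℝ)}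

/-- All four quadrants have area 147. The hypothesis `hlr` rules out a single with mirror lines on
both sides, whose cell is a rectangle. -/
lemma hasCore_single (hl : IsSingleReach l) (hr : IsSingleReach r)
    (hlr : 12 < (l 0 + r 0 + (l 20 + r 20)) / 2)
    (hsub : ∀ t s, -(49 / 2) < t → t < 49 / 2 → c - l t < s → s < c + r t → (t, s) ∈ V)
    (hsup : ∀ t s, (t, s) ∈ V →
      ((-(49 / 2) ≤ t ∧ t ≤ 49 / 2) ∧ c - l t ≤ s ∧ s ≤ c + r t)) :
    HasCore 588 (0, c) V := by
  obtain ⟨cl, pl, l1, l2, l10⟩ := hl.facts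
  obtain ⟨cr, pr, r1, r2, r10⟩ := hr.facts
  refine hasCore_of_fan (t₀ := -(49 / 2)) (t₁ := 49 / 2) cl cr (by norm_num) (by norm_num)
    (fun t _ => pl t) (fun t _ => pr t) l1 l2 r1 r2 (by norm_num) (by norm_num) (by norm_num)
    (fun x hx => hsub x.1 x.2 hx.1.1 hx.1.2 hx.2.1 hx.2.2) (fun x hx => hsup x.1 x.2 hx) ?_
  -- Every reach equals 6 at `10`, while `singleReach` is 16 at `0` and 2 at `20`, with mean 9.
  refine not_isRectangle_fan_of_width cl cr (by norm_num)
    (fun t _ => add_pos (pl t) (pr t)) (s := 0) (t := 20) ?_ ?_ ?_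
  · constructor <;> norm_num
  · constructor <;> norm_num
  · rw [show ((0 : ℝ) + 20) / 2 = 10 by norm_num, l10, r10]; linarith

/-- Opposite quadrants have equal area: the mirror side contributes `12 * 14 = 168` inside and `12 *
21 / 2 = 126` outside, the other side 126 inside and 168 outside. -/
lemma hasCore_upper_pair
    (hlr : l = (fun _ => 12) ∧ r = pairReach ∨ l = pairReach ∧ r = (fun _ => 12))
    (hsub : ∀ t s, 0 < t → t < 49 / 2 → c - l t < s → s < c + r t → (t, s) ∈ V)
    (hsup : ∀ t s, (t, s) ∈ V → ((0 ≤ t ∧ t ≤ 49 / 2) ∧ c - l t ≤ s ∧ s ≤ c + r t)) :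
    HasCore 588 (14, c) V := by
  rcases hlr with ⟨rfl, rfl⟩ | ⟨rfl, rfl⟩
  · refine hasCore_of_fan (t₀ := 0) (t₁ := 49 / 2) continuous_const continuous_pairReach
      (by norm_num) (by norm_num) (fun t _ => by norm_num) (fun t _ => pairReach_pos t)
      (intervalIntegral.integral_const _) (intervalIntegral.integral_const _)
      integral_pairReach_inner integral_pairReach_outer (by norm_num) (by norm_num) (by norm_num)
      (fun x hx => hsub x.1 x.2 hx.1.1 hx.1.2 hx.2.1 hx.2.2) (fun x hx => hsup x.1 x.2 hx) ?_
    refine not_isRectangle_fan_of_asymm continuous_const continuous_pairReach (by norm_num)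
      (fun t _ => add_pos (by norm_num) (pairReach_pos t)) (s := 0) (t := 14) ?_ ?_ ?_
    · constructor <;> norm_num
    · constructor <;> norm_num
    · grind [pairReach]
  · refine hasCore_of_fan (t₀ := 0) (t₁ := 49 / 2) continuous_pairReach continuous_const
      (by norm_num) (by norm_num) (fun t _ => pairReach_pos t) (fun t _ => by norm_num)
      integral_pairReach_inner integral_pairReach_outer
      (intervalIntegral.integral_const _) (intervalIntegral.integral_const _)
      (by norm_num) (by norm_num) (by norm_num)
      (fun x hx => hsub x.1 x.2 hx.1.1 hx.1.2 hx.2.1 hx.2.2) (fun x hx => hsup x.1 x.2 hx) ?_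
    refine not_isRectangle_fan_of_asymm continuous_pairReach continuous_const (by norm_num)
      -- The reflection sends these values to `0` and `14`, where `pairReach` is 2 and 16.
      (fun t _ => add_pos (pairReach_pos t) (by norm_num)) (s := 49 / 2) (t := 21 / 2) ?_ ?_ ?_
    · constructor <;> norm_num
    · constructor <;> norm_num
    · grind [pairReach]

lemma hasCore_lower_pair
    (hlr : l = (fun _ => 12) ∧ r = pairReach ∨ l = pairReach ∧ r = (fun _ => 12))
    (hsub : ∀ t s, -(49 / 2) < t → t < 0 → c - l t < s → s < c + r t → (t, s) ∈ V)
    (hsup : ∀ t s, (t, s) ∈ V → ((-(49 / 2) ≤ t ∧ t ≤ 0) ∧ c - l t ≤ s ∧ s ≤ c + r t)) :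
    HasCore 588 (-14, c) V := by
  rcases hlr with ⟨rfl, rfl⟩ | ⟨rfl, rfl⟩
  · refine hasCore_of_fan (t₀ := -(49 / 2)) (t₁ := 0) continuous_const continuous_pairReach
      (by norm_num) (by norm_num) (fun t _ => by norm_num) (fun t _ => pairReach_pos t)
      (intervalIntegral.integral_const _) (intervalIntegral.integral_const _)
      integral_pairReach_neg_outer integral_pairReach_neg_inner
      (by norm_num) (by norm_num) (by norm_num)
      (fun x hx => hsub x.1 x.2 hx.1.1 hx.1.2 hx.2.1 hx.2.2) (fun x hx => hsup x.1 x.2 hx) ?_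
    refine not_isRectangle_fan_of_asymm continuous_const continuous_pairReach (by norm_num)
      (fun t _ => add_pos (by norm_num) (pairReach_pos t)) (s := 0) (t := -14) ?_ ?_ ?_
    · constructor <;> norm_num
    · constructor <;> norm_num
    · grind [pairReach]
  · refine hasCore_of_fan (t₀ := -(49 / 2)) (t₁ := 0) continuous_pairReach continuous_const
      (by norm_num) (by norm_num) (fun t _ => pairReach_pos t) (fun t _ => by norm_num)
      integral_pairReach_neg_outer integral_pairReach_neg_inner
      (intervalIntegral.integral_const _) (intervalIntegral.integral_const _)
      (by norm_num) (by norm_num) (by norm_num)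
      (fun x hx => hsub x.1 x.2 hx.1.1 hx.1.2 hx.2.1 hx.2.2) (fun x hx => hsup x.1 x.2 hx) ?_
    refine not_isRectangle_fan_of_asymm continuous_pairReach continuous_const (by norm_num)
      (fun t _ => add_pos (pairReach_pos t) (by norm_num)) (s := -(49 / 2)) (t := -(21 / 2)) ?_ ?_ ?_
    · constructor <;> norm_num
    · constructor <;> norm_num
    · grind [pairReach]

/-- Distance profile of a single on the mirror line next to it. -/
noncomputable def singleProfile (t : ℝ) : ℝ := |t| + 6

/-- Distance profile of a pair on the mirror line next to it. -/
noncomputable def pairProfile (t : ℝ) : ℝ := |(|t| - 14)| + 12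

/-- Membership in a Voronoi cell inside a strip, in coordinates. -/
lemma mk_mem_voronoiCell_strip {H a b u v t s : ℝ} {P : Finset (ℝ × ℝ)} :
    (t, s) ∈ voronoiCell (Icc (-H, a) (H, b)) P (u, v) ↔
      (-H ≤ t ∧ a ≤ s) ∧ (t ≤ H ∧ s ≤ b) ∧
        ∀ q ∈ P, q ≠ (u, v) → |t - u| + |s - v| < |t - q.1| + |s - q.2| := by
  rw [mem_voronoiCell, mem_Icc, and_assoc]
  rfl

/-- With horizontal offset 14 and vertical offset 18, the bisector falls with slope 1 up to the
pair's first coordinate and is horizontal beyond it. Once the fans are inserted, only piecewise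
linear inequalities remain. -/
lemma stripConfig_single_pair (a : ℝ) :
    StripConfig (49 / 2) 588 a (a + 36) singleProfile pairProfile
      {(0, a + 6), (14, a + 24), (-14, a + 24)} := by
  refine ⟨by linarith, ?_, ?_, ?_, ?_, ?_, ?_⟩
  · simp only [Finset.mem_insert, Finset.mem_singleton, forall_eq_or_imp, forall_eq, mem_Icc,
      mem_Ioo]
    grind
  · simp only [Finset.mem_insert, Finset.mem_singleton, forall_eq_or_imp, forall_eq]
    refine ⟨hasCore_single (l := fun _ => 6) (r := singleReach) (.inl rfl) (.inr rfl) ?_ ?_ ?_,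
      hasCore_upper_pair (l := pairReach) (r := fun _ => 12) (.inr ⟨rfl, rfl⟩) ?_ ?_,
      hasCore_lower_pair (l := pairReach) (r := fun _ => 12) (.inr ⟨rfl, rfl⟩) ?_ ?_⟩
    · grind [singleReach]
    all_goals
      simp only [mk_mem_voronoiCell_strip, Finset.mem_insert, Finset.mem_singleton,
        forall_eq_or_imp, forall_eq, ne_eq, Prod.mk.injEq]
      grind [singleReach, pairReach]
  all_goals
    simp only [Finset.mem_insert, Finset.mem_singleton, forall_eq_or_imp, forall_eq,
      exists_eq_or_imp, exists_eq_left]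
    grind [singleProfile, pairProfile]

lemma stripConfig_pair_single (a : ℝ) :
    StripConfig (49 / 2) 588 a (a + 36) pairProfile singleProfile
      {(0, a + 30), (14, a + 12), (-14, a + 12)} := by
  refine ⟨by linarith, ?_, ?_, ?_, ?_, ?_, ?_⟩
  · simp only [Finset.mem_insert, Finset.mem_singleton, forall_eq_or_imp, forall_eq, mem_Icc,
      mem_Ioo]
    grind
  · simp only [Finset.mem_insert, Finset.mem_singleton, forall_eq_or_imp, forall_eq]
    refine ⟨hasCore_single (l := singleReach) (r := fun _ => 6) (.inr rfl) (.inl rfl) ?_ ?_ ?_,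
      hasCore_upper_pair (l := fun _ => 12) (r := pairReach) (.inl ⟨rfl, rfl⟩) ?_ ?_,
      hasCore_lower_pair (l := fun _ => 12) (r := pairReach) (.inl ⟨rfl, rfl⟩) ?_ ?_⟩
    · grind [singleReach]
    all_goals
      simp only [mk_mem_voronoiCell_strip, Finset.mem_insert, Finset.mem_singleton,
        forall_eq_or_imp, forall_eq, ne_eq, Prod.mk.injEq]
      grind [singleReach, pairReach]
  all_goals
    simp only [Finset.mem_insert, Finset.mem_singleton, forall_eq_or_imp, forall_eq,
      exists_eq_or_imp, exists_eq_left]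
    grind [singleProfile, pairProfile]

lemma stripConfig_pair_single_pair (a : ℝ) :
    StripConfig (49 / 2) 588 a (a + 60) pairProfile pairProfile
      {(0, a + 30), (14, a + 12), (-14, a + 12), (14, a + 48), (-14, a + 48)} := by
  refine ⟨by linarith, ?_, ?_, ?_, ?_, ?_, ?_⟩
  · simp only [Finset.mem_insert, Finset.mem_singleton, forall_eq_or_imp, forall_eq, mem_Icc,
      mem_Ioo]
    grind
  · simp only [Finset.mem_insert, Finset.mem_singleton, forall_eq_or_imp, forall_eq]
    refine ⟨hasCore_single (l := singleReach) (r := singleReach) (.inr rfl) (.inr rfl) ?_ ?_ ?_,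
      hasCore_upper_pair (l := fun _ => 12) (r := pairReach) (.inl ⟨rfl, rfl⟩) ?_ ?_,
      hasCore_lower_pair (l := fun _ => 12) (r := pairReach) (.inl ⟨rfl, rfl⟩) ?_ ?_,
      hasCore_upper_pair (l := pairReach) (r := fun _ => 12) (.inr ⟨rfl, rfl⟩) ?_ ?_,
      hasCore_lower_pair (l := pairReach) (r := fun _ => 12) (.inr ⟨rfl, rfl⟩) ?_ ?_⟩
    · grind [singleReach]
    all_goals
      simp only [mk_mem_voronoiCell_strip, Finset.mem_insert, Finset.mem_singleton,
        forall_eq_or_imp, forall_eq, ne_eq, Prod.mk.injEq]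
      grind [singleReach, pairReach]
  all_goals
    simp only [Finset.mem_insert, Finset.mem_singleton, forall_eq_or_imp, forall_eq,
      exists_eq_or_imp, exists_eq_left]
    grind [singleProfile, pairProfile]

/-! ### The skew brick, for two and four points -/

/-- The point sits off centre by 1, so the flat side has quadrants 12 and 8; the bent bisector gives
8 and 12 on the other side and restores both medians. -/
lemma hasCore_skew_right
    (hlr : l = (fun _ => 2) ∧ r = skewReach ∨ l = skewReach ∧ r = (fun _ => 2))
    (hsub : ∀ t s, -5 < t → t < 5 → c - l t < s → s < c + r t → (t, s) ∈ V)
    (hsup : ∀ t s, (t, s) ∈ V → ((-5 ≤ t ∧ t ≤ 5) ∧ c - l t ≤ s ∧ s ≤ c + r t)) :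
    HasCore 40 (1, c) V := by
  rcases hlr with ⟨rfl, rfl⟩ | ⟨rfl, rfl⟩
  · refine hasCore_of_fan (t₀ := -5) (t₁ := 5) continuous_const continuous_skewReach
      (by norm_num) (by norm_num) (fun t _ => by norm_num) (fun t _ => skewReach_pos t)
      (intervalIntegral.integral_const _) (intervalIntegral.integral_const _)
      integral_skewReach_left integral_skewReach_right (by norm_num) (by norm_num) (by norm_num)
      (fun x hx => hsub x.1 x.2 hx.1.1 hx.1.2 hx.2.1 hx.2.2) (fun x hx => hsup x.1 x.2 hx) ?_
    refine not_isRectangle_fan_of_asymm continuous_const continuous_skewReach (by norm_num)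
      (fun t _ => add_pos (by norm_num) (skewReach_pos t)) (s := -5) (t := 5) ?_ ?_ ?_
    · constructor <;> norm_num
    · constructor <;> norm_num
    · grind [skewReach]
  · refine hasCore_of_fan (t₀ := -5) (t₁ := 5) continuous_skewReach continuous_const
      (by norm_num) (by norm_num) (fun t _ => skewReach_pos t) (fun t _ => by norm_num)
      integral_skewReach_left integral_skewReach_right
      (intervalIntegral.integral_const _) (intervalIntegral.integral_const _) (by norm_num) (by norm_num) (by norm_num)
      (fun x hx => hsub x.1 x.2 hx.1.1 hx.1.2 hx.2.1 hx.2.2) (fun x hx => hsup x.1 x.2 hx) ?_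
    refine not_isRectangle_fan_of_asymm continuous_skewReach continuous_const (by norm_num)
      (fun t _ => add_pos (skewReach_pos t) (by norm_num)) (s := -5) (t := 5) ?_ ?_ ?_
    · constructor <;> norm_num
    · constructor <;> norm_num
    · grind [skewReach]

lemma hasCore_skew_left
    (hlr : l = (fun _ => 2) ∧ r = (fun t => skewReach (-t)) ∨ l = (fun t => skewReach (-t)) ∧ r = (fun _ => 2))
    (hsub : ∀ t s, -5 < t → t < 5 → c - l t < s → s < c + r t → (t, s) ∈ V)
    (hsup : ∀ t s, (t, s) ∈ V → ((-5 ≤ t ∧ t ≤ 5) ∧ c - l t ≤ s ∧ s ≤ c + r t)) :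
    HasCore 40 (-1, c) V := by
  rcases hlr with ⟨rfl, rfl⟩ | ⟨rfl, rfl⟩
  · refine hasCore_of_fan (t₀ := -5) (t₁ := 5) continuous_const (continuous_skewReach.comp continuous_neg)
      (by norm_num) (by norm_num) (fun t _ => by norm_num) (fun t _ => skewReach_pos (-t))
      (intervalIntegral.integral_const _) (intervalIntegral.integral_const _)
      integral_skewReach_neg_left integral_skewReach_neg_right (by norm_num) (by norm_num) (by norm_num)
      (fun x hx => hsub x.1 x.2 hx.1.1 hx.1.2 hx.2.1 hx.2.2) (fun x hx => hsup x.1 x.2 hx) ?_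
    refine not_isRectangle_fan_of_asymm continuous_const (continuous_skewReach.comp continuous_neg) (by norm_num)
      (fun t _ => add_pos (by norm_num) (skewReach_pos (-t))) (s := -5) (t := 5) ?_ ?_ ?_
    · constructor <;> norm_num
    · constructor <;> norm_num
    · grind [skewReach]
  · refine hasCore_of_fan (t₀ := -5) (t₁ := 5) (continuous_skewReach.comp continuous_neg) continuous_const
      (by norm_num) (by norm_num) (fun t _ => skewReach_pos (-t)) (fun t _ => by norm_num)
      integral_skewReach_neg_left integral_skewReach_neg_right
      (intervalIntegral.integral_const _) (intervalIntegral.integral_const _) (by norm_num) (by norm_num) (by norm_num)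
      (fun x hx => hsub x.1 x.2 hx.1.1 hx.1.2 hx.2.1 hx.2.2) (fun x hx => hsup x.1 x.2 hx) ?_
    refine not_isRectangle_fan_of_asymm (continuous_skewReach.comp continuous_neg) continuous_const (by norm_num)
      (fun t _ => add_pos (skewReach_pos (-t)) (by norm_num)) (s := -5) (t := 5) ?_ ?_ ?_
    · constructor <;> norm_num
    · constructor <;> norm_num
    · grind [skewReach]

lemma stripConfig_skew (a : ℝ) :
    StripConfig 5 40 a (a + 8) (fun t => |t + 1| + 2) (fun t => |t - 1| + 2)
      {(-1, a + 2), (1, a + 6)} := by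
  refine ⟨by linarith, ?_, ?_, ?_, ?_, ?_, ?_⟩
  · simp only [Finset.mem_insert, Finset.mem_singleton, forall_eq_or_imp, forall_eq, mem_Icc,
      mem_Ioo]
    grind
  · simp only [Finset.mem_insert, Finset.mem_singleton, forall_eq_or_imp, forall_eq]
    refine ⟨hasCore_skew_left (l := fun _ => 2) (r := fun t => skewReach (-t)) (.inl ⟨rfl, rfl⟩) ?_ ?_,
      hasCore_skew_right (l := skewReach) (r := fun _ => 2) (.inr ⟨rfl, rfl⟩) ?_ ?_⟩
    all_goals
      simp only [mk_mem_voronoiCell_strip, Finset.mem_insert, Finset.mem_singleton,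
        forall_eq_or_imp, forall_eq, ne_eq, Prod.mk.injEq]
      grind [skewReach]
  all_goals
    simp only [Finset.mem_insert, Finset.mem_singleton, forall_eq_or_imp, forall_eq,
      exists_eq_or_imp, exists_eq_left]
    grind

lemma stripConfig_skew_mirror (a : ℝ) :
    StripConfig 5 40 a (a + 8) (fun t => |t - 1| + 2) (fun t => |t + 1| + 2)
      {(1, a + 2), (-1, a + 6)} := by
  refine ⟨by linarith, ?_, ?_, ?_, ?_, ?_, ?_⟩
  · simp only [Finset.mem_insert, Finset.mem_singleton, forall_eq_or_imp, forall_eq, mem_Icc,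
      mem_Ioo]
    grind
  · simp only [Finset.mem_insert, Finset.mem_singleton, forall_eq_or_imp, forall_eq]
    refine ⟨hasCore_skew_right (l := fun _ => 2) (r := skewReach) (.inl ⟨rfl, rfl⟩) ?_ ?_,
      hasCore_skew_left (l := fun t => skewReach (-t)) (r := fun _ => 2) (.inr ⟨rfl, rfl⟩) ?_ ?_⟩
    all_goals
      simp only [mk_mem_voronoiCell_strip, Finset.mem_insert, Finset.mem_singleton,
        forall_eq_or_imp, forall_eq, ne_eq, Prod.mk.injEq]
      grind [skewReach]
  all_goals
    simp only [Finset.mem_insert, Finset.mem_singleton, forall_eq_or_imp, forall_eq,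
      exists_eq_or_imp, exists_eq_left]
    grind

/-! ### Which numbers of points occur -/

/-- There is a strip configuration of `n` points ending with a pair. -/
def Reachable (n : ℕ) : Prop :=
  ∃ (a b : ℝ) (f : ℝ → ℝ) (P : Finset (ℝ × ℝ)),
    StripConfig (49 / 2) 588 a b f pairProfile P ∧ P.card = n

lemma StripConfig.exists_glue {H A a b c : ℝ} {f g h : ℝ → ℝ} {P Q : Finset (ℝ × ℝ)}
    (hP : StripConfig H A a b f g P) (hQ : StripConfig H A b c g h Q) :
    ∃ P', StripConfig H A a c f h P' ∧ P'.card = P.card + Q.card :=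
  ⟨P ∪ Q, hP.glue hQ, Finset.card_union_of_disjoint (hP.disjoint hQ)⟩

lemma card_three_brick (u v w : ℝ) :
    ({(0, u), (14, v), (-14, w)} : Finset (ℝ × ℝ)).card = 3 := by
  rw [Finset.card_eq_three]
  refine ⟨_, _, _, ?_, ?_, ?_, rfl⟩ <;> simp only [ne_eq, Prod.mk.injEq, not_and] <;> norm_num

lemma card_five_brick (a : ℝ) :
    ({(0, a + 30), (14, a + 12), (-14, a + 12), (14, a + 48), (-14, a + 48)} :
      Finset (ℝ × ℝ)).card = 5 := by
  repeat rw [Finset.card_insert_of_notMem (by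
    simp only [Finset.mem_insert, Finset.mem_singleton, Prod.mk.injEq]; norm_num)]
  simp

lemma reachable_three : Reachable 3 :=
  ⟨_, _, _, _, stripConfig_single_pair 0, card_three_brick _ _ _⟩

lemma reachable_five : Reachable 5 :=
  ⟨_, _, _, _, stripConfig_pair_single_pair 0, card_five_brick _⟩

/-- The two three-point bricks are joined along their single edges, leaving a pair at either end. -/
lemma reachable_six : Reachable 6 := by
  obtain ⟨P, h, hc⟩ := (stripConfig_pair_single 0).exists_glue (stripConfig_single_pair _)
  exact ⟨_, _, _, P, h, by rw [hc, card_three_brick, card_three_brick]⟩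

lemma Reachable.add_five {n : ℕ} (h : Reachable n) : Reachable (n + 5) := by
  obtain ⟨a, b, f, P, hP, rfl⟩ := h
  obtain ⟨Q, hQ, hc⟩ := hP.exists_glue (stripConfig_pair_single_pair b)
  exact ⟨_, _, _, Q, hQ, by rw [hc, card_five_brick]⟩

lemma Reachable.add_six {n : ℕ} (h : Reachable n) : Reachable (n + 6) := by
  obtain ⟨a, b, f, P, hP, rfl⟩ := h
  obtain ⟨Q, hQ, hc⟩ := hP.exists_glue (stripConfig_pair_single b)
  obtain ⟨Q', hQ', hc'⟩ := hQ.exists_glue (stripConfig_single_pair _)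
  exact ⟨_, _, _, Q', hQ', by rw [hc', hc, card_three_brick, card_three_brick]⟩

lemma reachable_of_eight_le (n : ℕ) (hn : 8 ≤ n) : Reachable n := by
  induction n using Nat.strong_induction_on with
  | _ n ih =>
    by_cases h : 13 ≤ n
    · have := (ih (n - 5) (by omega) (by omega)).add_five
      rwa [Nat.sub_add_cancel (by omega)] at this
    -- Five consecutive base cases suffice, since the pair-single-pair brick adds 5.
    · have : n = 8 ∨ n = 9 ∨ n = 10 ∨ n = 11 ∨ n = 12 := by omega
      rcases this with rfl | rfl | rfl | rfl | rfl
      · exact reachable_three.add_five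
      · exact reachable_three.add_six
      · exact reachable_five.add_five
      · exact reachable_six.add_five
      · exact reachable_six.add_six

lemma Reachable.exists_rectangle {n : ℕ} (h : Reachable n) :
    ∃ (a b : ℝ × ℝ) (P : Finset (ℝ × ℝ)), a.1 < b.1 ∧ a.2 < b.2 ∧
      (P : Set (ℝ × ℝ)) ⊆ Set.Icc a b ∧ P.card = n ∧ Balanced (Set.Icc a b) P ∧
      ∀ p ∈ P, ¬ IsRectangle (voronoiCell (Set.Icc a b) P p) := by
  obtain ⟨a, b, f, P, hP, rfl⟩ := h
  exact hP.exists_rectangle (by norm_num)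

end ManhattanVoronoi

/-- The rectangle `Set.Icc a b` is the closed axis-parallel rectangle
`[a.1, b.1] × [a.2, b.2]`. -/
theorem theorem3p4 (n : ℕ) (hn1 : n ≠ 1) (hn7 : n ≠ 7) :
    ∃ (a b : ℝ × ℝ) (P : Finset (ℝ × ℝ)),
      a.1 < b.1 ∧ a.2 < b.2 ∧
      (P : Set (ℝ × ℝ)) ⊆ Set.Icc a b ∧
      P.card = n ∧
      ManhattanVoronoi.Balanced (Set.Icc a b) P ∧
      ∀ p ∈ P, ¬ ManhattanVoronoi.IsRectangle (ManhattanVoronoi.voronoiCell (Set.Icc a b) P p) := by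
  open ManhattanVoronoi in
  have hskew : ∀ u v : ℝ, ({(-1, u), (1, v)} : Finset (ℝ × ℝ)).card = 2 := fun u v =>
    Finset.card_pair (by simp only [ne_eq, Prod.mk.injEq, not_and]; norm_num)
  have hskew' : ∀ u v : ℝ, ({(1, u), (-1, v)} : Finset (ℝ × ℝ)).card = 2 := fun u v =>
    Finset.card_pair (by simp only [ne_eq, Prod.mk.injEq, not_and]; norm_num)
  by_cases h8 : 8 ≤ n
  · exact (reachable_of_eight_le n h8).exists_rectangle
  · have : n = 0 ∨ n = 2 ∨ n = 3 ∨ n = 4 ∨ n = 5 ∨ n = 6 := by omega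
    rcases this with rfl | rfl | rfl | rfl | rfl | rfl
    · exact ⟨(0, 0), (1, 1), ∅, by norm_num, by norm_num, by simp, rfl, ⟨by simp, by simp⟩, by simp⟩
    · rw [← hskew (0 + 2) (0 + 6)]
      exact (stripConfig_skew 0).exists_rectangle (by norm_num)
    · exact reachable_three.exists_rectangle
    -- The skew brick is not symmetric, so its upper edge only matches the lower edge of its mirror
    -- image.
    · obtain ⟨P, h, hc⟩ := (stripConfig_skew 0).exists_glue (stripConfig_skew_mirror _)
      rw [hskew, hskew'] at hc
      rw [show 4 = P.card from hc.symm]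
      exact h.exists_rectangle (by norm_num)
    · exact reachable_five.exists_rectangle
    · exact reachable_six.exists_rectangle
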